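/- Let $p$ be an odd prime, $q=p^a$ with $a\ge 1$, and let $S$ be a Sylow $p$-subgroup of $\mathrm{Sp}_4(\mathbf F_q)$. Write $[x,y]=xyx^{-1}y^{-1}$. Then $|S|=q^4=p^{4a}$, and the minimal number of generators of $S$ is $d(S)=2a$. Moreover, $S$ has the following explicit presentation. Let $\alpha$ (short) and $\beta$ (long) be simple roots of the root system $C_2$. After conjugation in $\mathrm{Sp}_4(\mathbf F_q)$ there are root elements $x_\alpha(t),x_\beta(t),x_{\alpha+\beta}(t),x_{2\alpha+\beta}(t)\in S$ ($t\in\mathbf F_q$), the simultaneous conjugates of the standard ones, normalized so that $[x_\beta(t),x_\alpha(s)]=x_{\alpha+\beta}(ts)\,x_{2\alpha+\beta}(ts^2)$ and $[x_\alpha(s),x_{\alpha+\beta}(t)]=x_{2\alpha+\beta}(2st)$. Let $v_1=1,v_2,\dots,v_a$ be any generators of the additive group of $\mathbf F_q$ (such generators exist). Choose any integers $m(j,i)$, $r(k,i)$, $c(k,k',s)$, $d(i,j,k)$, $f(i,j,k)$ (indices from $1$ to $a$; such integers exist) with $$\sum_j m(j,i)v_j=\tfrac12 v_i,\quad \sum_k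 r(k,i)v_k=-v_i^2,\quad \sum_s c(k,k',s)v_s=v_kv_{k'},\quad \sum_k d(i,j,k)v_k=v_iv_j,\quad \sum_k f(i,j,k)v_k=v_iv_j^2 .$$ Then the $2a$ elements $x_\alpha(v_k),x_\beta(v_k)$ ($1\le k\le a$) generate $S$, and in terms of them (all products taken in increasing order of the index) $$x_\alpha(\tfrac12v_i)=\prod_{j=1}^a x_\alpha(v_j)^{m(j,i)},\qquad x_{\alpha+\beta}(v_i)=[x_\beta(v_1),x_\alpha(v_i)]\prod_{k=1}^a\bigl[x_\alpha(\tfrac12v_k),[x_\beta(v_1),x_\alpha(v_1)]\bigr]^{r(k,i)},$$ $$x_{2\alpha+\beta}(v_i)=[x_\alpha(\tfrac12v_i),x_{\alpha+\beta}(v_1)].$$ Using these expressions, together with $$x_{\alpha+\beta}(v_iv_j):=\prod_{k=1}^a x_{\alpha+\beta}(v_k)^{d(i,j,k)},\qquad x_{2\alpha+\beta}(v_iv_j^2):=\prod_{k=1}^a x_{2\alpha+\beta}(v_k)^{f(i,j,k)},\qquad x_{2\alpha+\beta}(v_i^2):=x_{2\alpha+\beta}(v_1v_i^2),$$ as abbreviations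 for words in the symbols $x_\alpha(v_k),x_\beta(v_k)$, the group $S$ is presented by these $2a$ generators and the following relations, whose total number is $\frac{7a^2+13a}{2}$: - (C1) $x_\alpha(v_k)^p=1$, $x_\beta(v_k)^p=1$ and $x_{\alpha+\beta}(v_k)^p=1$ for $1\le k\le a$; - (C2) $[x_\alpha(v_k),x_\alpha(v_{k'})]=1$ for $1\le k<k'\le a$; - (C3) $[x_\beta(v_k),x_\beta(v_{k'})]=1$ for $1\le k<k'\le a$; - (C4) $[x_{\alpha+\beta}(v_k),x_{\alpha+\beta}(v_{k'})]=1$ for $1\le k<k'\le a$; - (C5) $[x_\alpha(v_1),[x_\alpha(v_k),x_{\alpha+\beta}(v_1)]]=1$ and $[x_{\alpha+\beta}(v_1),[x_\alpha(v_k),x_{\alpha+\beta}(v_1)]]=1$ for $1\le k\le a$; - (C6) $[x_\alpha(v_k)^{-1},x_{\alpha+\beta}(v_{k'})^{-1}]=\prod_{s=1}^a[x_\alpha(v_s),x_{\alpha+\beta}(v_1)]^{c(k,k',s)}$ for $1\le k\le a$, $2\le k'\le a$; - (C7) $[x_{\alpha+\beta}(v_1),x_\beta(v_i)]=1$ for $1\le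 i\le a$; - (C8) $[x_{\alpha+\beta}(v_i),x_\beta(v_1)]=1$ for $1\le i\le a$; - (C9) $x_{2\alpha+\beta}(v_i^2)^{-1}=\prod_{k=1}^a x_{2\alpha+\beta}(v_k)^{r(k,i)}$ for $1\le i\le a$; - (C10) $[x_\beta(v_1),x_\alpha(v_i)]=x_{\alpha+\beta}(v_i)\,x_{2\alpha+\beta}(v_i^2)$ for $1\le i\le a$; - (C11) $[x_\alpha(v_j)^{-1},x_\beta(v_i)^{-1}]=x_{\alpha+\beta}(v_iv_j)^{-1}\,x_{2\alpha+\beta}(v_iv_j^2)$ for $1\le i,j\le a$. -/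

import Mathlib

open scoped commutatorElement

namespace Sp4Sylow

/-- The positive roots of the root system of type `C₂`, with simple roots `α` (short) and
`β` (long): `α`, `β`, `α + β` and `2α + β`. -/
inductive PosRoot : Type
  | α : PosRoot
  | β : PosRoot
  | αβ : PosRoot
  | ααβ : PosRoot

/-- The root element `x_γ(t)` as a `4 × 4` matrix, written in `2 × 2` blocks with respect to
the symplectic form `Matrix.J` (so `α = e₁ - e₂`, `β = 2e₂`, `α + β = e₁ + e₂`, `2α + β = 2e₁`).
The signs are those for which `[x_β(t), x_α(s)] = x_{α+β}(ts) x_{2α+β}(ts²)` and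
`[x_α(s), x_{α+β}(t)] = x_{2α+β}(2st)`. -/
def rootMatrix {F : Type*} [Field F] : PosRoot → F → Matrix (Fin 2 ⊕ Fin 2) (Fin 2 ⊕ Fin 2) F
  | .α, t => Matrix.fromBlocks !![1, t; 0, 1] 0 0 !![1, 0; -t, 1]
  | .β, t => Matrix.fromBlocks 1 !![0, 0; 0, -t] 0 1
  | .αβ, t => Matrix.fromBlocks 1 !![0, t; t, 0] 0 1
  | .ααβ, t => Matrix.fromBlocks 1 !![t, 0; 0, 0] 0 1

theorem rootMatrix_mem {F : Type*} [Field F] (γ : PosRoot) (t : F) :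
    rootMatrix γ t ∈ Matrix.symplecticGroup (Fin 2) F := by
  rw [SymplecticGroup.mem_iff]
  cases γ <;>
  · simp only [rootMatrix, Matrix.J, Matrix.fromBlocks_transpose, Matrix.fromBlocks_multiply]
    congr 1 <;> ext i j <;> fin_cases i <;> fin_cases j <;>
      simp [Matrix.vecMul, dotProduct, Fin.sum_univ_two]

/-- The root element `x_γ(t)` of `Sp₄(F)`. -/
def rootElement {F : Type*} [Field F] (γ : PosRoot) (t : F) : Matrix.symplecticGroup (Fin 2) F :=
  ⟨rootMatrix γ t, rootMatrix_mem γ t⟩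

/-- `v 0, …, v (a - 1)` (in the mathematical numbering `v₁, …, v_a`) generate the additive group
of `F`, and the first of them is `1`. -/
structure IsNormalizedGenerating {a : ℕ} [NeZero a] {F : Type*} [Field F] (v : Fin a → F) :
    Prop where
  first : v 0 = 1
  closure_eq_top : AddSubgroup.closure (Set.range v) = ⊤

/-- Integers expressing the following elements of `F` in terms of `v₁, …, v_a`: `v_i / 2` (the
`m`'s), `-v_i²` (the `r`'s), `v_k v_k'` (the `c`'s), `v_i v_j` (the `d`'s), `v_i v_j²` (the `f`'s). -/
structure Exponents {a : ℕ} {F : Type*} [Field F] (v : Fin a → F) where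
  m : Fin a → Fin a → ℤ
  r : Fin a → Fin a → ℤ
  c : Fin a → Fin a → Fin a → ℤ
  d : Fin a → Fin a → Fin a → ℤ
  f : Fin a → Fin a → Fin a → ℤ
  m_spec : ∀ i, ∑ j, (m j i : F) * v j = v i / 2
  r_spec : ∀ i, ∑ k, (r k i : F) * v k = -(v i) ^ 2
  c_spec : ∀ k k', ∑ s, (c k k' s : F) * v s = v k * v k'
  d_spec : ∀ i j, ∑ k, (d i j k : F) * v k = v i * v j
  f_spec : ∀ i j, ∑ k, (f i j k : F) * v k = v i * v j ^ 2

/-- The ordered product `g₁ ^ n₁ * ⋯ * g_a ^ n_a`. -/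
def prodPow {a : ℕ} {G : Type*} [Group G] (g : Fin a → G) (n : Fin a → ℤ) : G :=
  (List.ofFn fun k => g k ^ n k).prod

section Words

variable {a : ℕ} [NeZero a] {F : Type*} [Field F] {v : Fin a → F} (K : Exponents v)
  {G : Type*} [Group G] (A B : Fin a → G)

/-- The word for `x_α(v_i / 2)`, where `A k` stands for `x_α(v_k)`. -/
def halfα (i : Fin a) : G := prodPow A fun j => K.m j i

/-- The word for `x_{α+β}(v_i)`, where `A k` stands for `x_α(v_k)` and `B k` for `x_β(v_k)`. -/
def wordαβ (i : Fin a) : G :=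
  ⁅B 0, A i⁆ * prodPow (fun k => ⁅halfα K A k, ⁅B 0, A 0⁆⁆) fun k => K.r k i

/-- The word for `x_{2α+β}(v_i)`. -/
def wordααβ (i : Fin a) : G := ⁅halfα K A i, wordαβ K A B 0⁆

/-- The word for `x_{α+β}(v_i v_j)`. -/
def wordαβMul (i j : Fin a) : G := prodPow (wordαβ K A B) (K.d i j)

/-- The word for `x_{2α+β}(v_i v_j²)`. As `v₁ = 1`, the case `i = 0` is the word for
`x_{2α+β}(v_j²)`. -/
def wordααβMulSq (i j : Fin a) : G := prodPow (wordααβ K A B) (K.f i j)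

end Words

/-- The index set of the relations `C1`–`C11` (indices run over `0, …, a - 1` instead of
`1, …, a`). -/
inductive RelIndex (a : ℕ) [NeZero a] : Type
  | C1α (k : Fin a) : RelIndex a
  | C1β (k : Fin a) : RelIndex a
  | C1αβ (k : Fin a) : RelIndex a
  | C2 (k k' : Fin a) (h : k < k') : RelIndex a
  | C3 (k k' : Fin a) (h : k < k') : RelIndex a
  | C4 (k k' : Fin a) (h : k < k') : RelIndex a
  | C5α (k : Fin a) : RelIndex a
  | C5αβ (k : Fin a) : RelIndex a
  | C6 (k k' : Fin a) (h : k' ≠ 0) : RelIndex a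
  | C7 (i : Fin a) : RelIndex a
  | C8 (i : Fin a) : RelIndex a
  | C9 (i : Fin a) : RelIndex a
  | C10 (i : Fin a) : RelIndex a
  | C11 (i j : Fin a) : RelIndex a

section Relations

variable (p : ℕ) {a : ℕ} [NeZero a] {F : Type*} [Field F] {v : Fin a → F} (K : Exponents v)
  {G : Type*} [Group G] (A B : Fin a → G)

/-- The left-hand sides of the relations. -/
def relLHS : RelIndex a → G
  | .C1α k => A k ^ p
  | .C1β k => B k ^ p
  | .C1αβ k => wordαβ K A B k ^ p
  | .C2 k k' _ => ⁅A k, A k'⁆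
  | .C3 k k' _ => ⁅B k, B k'⁆
  | .C4 k k' _ => ⁅wordαβ K A B k, wordαβ K A B k'⁆
  | .C5α k => ⁅A 0, ⁅A k, wordαβ K A B 0⁆⁆
  | .C5αβ k => ⁅wordαβ K A B 0, ⁅A k, wordαβ K A B 0⁆⁆
  | .C6 k k' _ => ⁅(A k)⁻¹, (wordαβ K A B k')⁻¹⁆
  | .C7 i => ⁅wordαβ K A B 0, B i⁆
  | .C8 i => ⁅wordαβ K A B i, B 0⁆
  | .C9 i => (wordααβMulSq K A B 0 i)⁻¹
  | .C10 i => ⁅B 0, A i⁆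
  | .C11 i j => ⁅(A j)⁻¹, (B i)⁻¹⁆

/-- The right-hand sides of the relations. -/
def relRHS : RelIndex a → G
  | .C6 k k' _ => prodPow (fun s => ⁅A s, wordαβ K A B 0⁆) (K.c k k')
  | .C9 i => prodPow (wordααβ K A B) fun k => K.r k i
  | .C10 i => wordαβ K A B i * wordααβMulSq K A B 0 i
  | .C11 i j => (wordαβMul K A B i j)⁻¹ * wordααβMulSq K A B i j
  | _ => 1

end Relations

/-- The relators `LHS * RHS⁻¹` of the relations, in the free group on the `2a` letters
`x_α(v_k)` (`Sum.inl k`) and `x_β(v_k)` (`Sum.inr k`). -/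
def relator (p : ℕ) {a : ℕ} [NeZero a] {F : Type*} [Field F] {v : Fin a → F} (K : Exponents v)
    (ι : RelIndex a) : FreeGroup (Fin a ⊕ Fin a) :=
  relLHS p K (fun k => FreeGroup.of (Sum.inl k)) (fun k => FreeGroup.of (Sum.inr k)) ι *
    (relRHS K (fun k => FreeGroup.of (Sum.inl k)) (fun k => FreeGroup.of (Sum.inr k)) ι)⁻¹

end Sp4Sylow

/-!
The theorem has a half about matrices and a half about an abstract group given by the relations.

*The Sylow subgroup.* Let `U` be the group of symplectic matrices acting trivially on the factors
of the flag `⟨e₁⟩ < ⟨e₁, e₂⟩`. Each of its elements is uniquely `x_α(s) x_β(t) x_{α+β}(u)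
x_{2α+β}(w)`, so `|U| = q⁴` (`card_unipotentRadical`). The flag is determined by `U`, so an
element normalizing `U` stabilizes it, and such an element of `p`-power order has eigenvalues `1`
there, that is, lies in `U` (`mem_unipotentRadical_of_normalizes`). Since normalizers grow in
`p`-groups, `U` is a Sylow subgroup. Its rank is `2a`: the `x_α(v_k)`, `x_β(v_k)` generate it, and
it maps onto the elementary abelian group `F × F`. The root elements satisfy the commutator
formulas of type `C₂`, from which all the relations follow (`IsRootFamily.relLHS_eq_relRHS`).

*The order of the presented group.* It remains to see that a group generated by `A k`, `B k` which
satisfy the relations has order at most `q⁴`. Write `P k` for the word for `x_{α+β}(v_k)` and put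
`Z k = ⁅A k, P 0⁆`. The relations `C5αβ` and `C6` make `P 0` commute with `⁅(A k)⁻¹, (P l)⁻¹⁆`,
hence `P l` with the conjugate of `P 0` by `A k`, hence `P l` with `Z k`. As the `v_k` are
linearly independent over `𝔽_p`, the instances of `C6` involving `A 0` say that `⁅(A 0)⁻¹, (P
k)⁻¹⁆ = Z k` (`commutator_inv_inv_eq`). This second expression for `Z k` shows that the `Z k`
commute with each other, and that each `A l`, which moves `(P k)⁻¹` only by elements commuting
with `A 0` and `P k`, commutes with `Z k` (`commute_commutator_of_heisenberg_relations`). By `C7`,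
`C8`, `C10` and `C11` the `B i` move the `A k` only by products of elements `P` and `Z`, which
yields first that `B i` commutes with `Z k`, then with `P k ≡ ⁅B 0, A k⁆` modulo `⟨Z⟩`. So `⟨Z⟩ ≤
⟨P, Z⟩ ≤ ⟨B, P, Z⟩ ≤ ⟨A, B, P, Z⟩` is a normal series whose factors are elementary abelian of rank
at most `a` (`finite_and_card_le_of_relations`).
-/

open scoped commutatorElement

namespace Sp4Sylow

/-! ### Ordered products of powers -/

section ProdPow

variable {a : ℕ} {G H : Type*} [Group G] [Group H]

theorem map_prodPow {M : Type*} [FunLike M G H] [MonoidHomClass M G H] (φ : M) (g : Fin a → G)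
    (n : Fin a → ℤ) : φ (prodPow g n) = prodPow (fun k => φ (g k)) n := by
  simp [prodPow, map_list_prod, List.map_ofFn, Function.comp_def]

theorem prodPow_mem {N : Subgroup G} {g : Fin a → G} (hg : ∀ k, g k ∈ N) (n : Fin a → ℤ) :
    prodPow g n ∈ N := by
  refine N.list_prod_mem fun x hx => ?_
  obtain ⟨k, rfl⟩ := (List.mem_ofFn' _ _).1 hx
  exact N.zpow_mem (hg k) _

theorem commute_prodPow {x : G} {g : Fin a → G} (hg : ∀ k, Commute x (g k)) (n : Fin a → ℤ) :
    Commute x (prodPow g n) := by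
  have := prodPow_mem (N := Subgroup.centralizer {x})
    (fun k => Subgroup.mem_centralizer_singleton_iff.2 (hg k).symm.eq) n
  exact (show Commute _ _ from Subgroup.mem_centralizer_singleton_iff.1 this).symm

/-- If the `g k` have exponent `p` and the exponent vector is a standard basis vector modulo `p`,
the ordered product is the corresponding `g k`; the `g j` need not commute. -/
theorem prodPow_eq_of_dvd_sub_single {p : ℕ} {g : Fin a → G} (hg : ∀ k, g k ^ p = 1) (k : Fin a)
    {n : Fin a → ℤ} (hn : ∀ j, (p : ℤ) ∣ n j - Pi.single (M := fun _ => ℤ) k 1 j) :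
    prodPow g n = g k := by
  have h1 : ∀ j, g j ^ n j = zpowersHom G (g k) (.ofAdd (Pi.single (M := fun _ => ℤ) k 1 j)) := by
    intro j
    obtain ⟨c, hc⟩ := hn j
    have h2 : g j ^ n j = g j ^ Pi.single (M := fun _ => ℤ) k 1 j := by
      rw [sub_eq_iff_eq_add.1 hc, zpow_add, zpow_mul, zpow_natCast, hg, one_zpow, one_mul]
    rw [h2]
    rcases eq_or_ne j k with rfl | h
    · simp
    · simp [h]
  have h3 : (List.ofFn fun j => Multiplicative.ofAdd (Pi.single (M := fun _ => ℤ) k 1 j)).prod =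
      Multiplicative.ofAdd 1 := by
    rw [List.prod_ofFn, ← ofAdd_sum]
    simp
  calc prodPow g n = (List.ofFn fun j =>
        zpowersHom G (g k) (.ofAdd (Pi.single (M := fun _ => ℤ) k 1 j))).prod := by
        simp only [prodPow, h1]
    _ = zpowersHom G (g k) (List.ofFn fun j =>
        Multiplicative.ofAdd (Pi.single (M := fun _ => ℤ) k 1 j)).prod := by
        rw [map_list_prod, List.map_ofFn]; rfl
    _ = g k := by rw [h3]; simp

end ProdPow

/-! ### Commutators fixed by an element -/

section Commutators

variable {G : Type*} [Group G]

theorem commute_commutator_of_conj_eq_mul_left {x g h m : G} (hx : Commute x h)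
    (hg : x * g * x⁻¹ = m * g) (hmh : Commute m h) (hm : Commute m ⁅g, h⁆) :
    Commute x ⁅g, h⁆ := by
  have h1 : x * ⁅g, h⁆ * x⁻¹ = ⁅x * g * x⁻¹, x * h * x⁻¹⁆ := by
    simp only [commutatorElement_def]; group
  have h2 : ⁅m * g, h⁆ = m * ⁅g, h⁆ * m⁻¹ * ⁅m, h⁆ := by
    simp only [commutatorElement_def]; group
  rw [hg, hx.mul_inv_cancel, h2, hm.mul_inv_cancel, commutatorElement_eq_one_iff_commute.2 hmh,
    mul_one] at h1
  exact mul_inv_eq_iff_eq_mul.1 h1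

theorem commute_commutator_of_conj_eq_mul_right {x g h m : G} (hx : Commute x h)
    (hg : x * g * x⁻¹ = g * m) (hmh : Commute m h) : Commute x ⁅g, h⁆ := by
  have h1 : x * ⁅g, h⁆ * x⁻¹ = ⁅x * g * x⁻¹, x * h * x⁻¹⁆ := by
    simp only [commutatorElement_def]; group
  have h2 : ⁅g * m, h⁆ = g * ⁅m, h⁆ * g⁻¹ * ⁅g, h⁆ := by
    simp only [commutatorElement_def]; group
  rw [hg, hx.mul_inv_cancel, h2, commutatorElement_eq_one_iff_commute.2 hmh,
    mul_one, mul_inv_cancel, one_mul] at h1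
  exact mul_inv_eq_iff_eq_mul.1 h1

end Commutators

/-! ### The subgroup generated by the short root elements -/

section Heisenberg

variable {p a : ℕ} [NeZero a] {G : Type*} [Group G] {A P : Fin a → G}

theorem commutator_pow_eq_one (hPp : P 0 ^ p = 1) (hPZ : ∀ k, Commute (P 0) ⁅A k, P 0⁆)
    (k : Fin a) : ⁅A k, P 0⁆ ^ p = 1 := by
  have h1 : ⁅A k, P 0⁆ * P 0 = A k * P 0 * (A k)⁻¹ := by
    simp only [commutatorElement_def]; group
  have h2 : (⁅A k, P 0⁆ * P 0) ^ p = 1 := by rw [h1, conj_pow, hPp]; group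
  rwa [(hPZ k).symm.mul_pow, hPp, mul_one] at h2

variable {c : Fin a → Fin a → Fin a → ℤ}
  (hPP : ∀ k l, Commute (P k) (P l))
  (hAZ : ∀ k, Commute (A 0) ⁅A k, P 0⁆)
  (hPZ : ∀ k, Commute (P 0) ⁅A k, P 0⁆)
  (hAP : ∀ k l, l ≠ 0 → ⁅(A k)⁻¹, (P l)⁻¹⁆ = prodPow (fun s => ⁅A s, P 0⁆) (c k l))

include hPP hPZ hAP in
/-- `P 0` commutes with `⁅(A k)⁻¹, (P l)⁻¹⁆`, a product of elements `⁅A s, P 0⁆`, and so with the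
conjugate of `P l` by `(A k)⁻¹`; conjugating back, `P l` commutes with that of `P 0` by `A k`. -/
theorem commute_commutator_of_center_relations (l k : Fin a) : Commute (P l) ⁅A k, P 0⁆ := by
  rcases eq_or_ne l 0 with rfl | hl
  · exact hPZ k
  have h1 : Commute (P 0) ⁅(A k)⁻¹, (P l)⁻¹⁆ := by
    rw [hAP k l hl]; exact commute_prodPow hPZ _
  have h2 : Commute (P 0) ((A k)⁻¹ * P l * A k) := by
    have : (A k)⁻¹ * P l * A k = (⁅(A k)⁻¹, (P l)⁻¹⁆ * (P l)⁻¹)⁻¹ := by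
      simp only [commutatorElement_def]; group
    rw [this]
    exact (h1.mul_right (hPP 0 l).inv_right).inv_right
  have h3 : Commute (A k * P 0 * (A k)⁻¹) (P l) := by
    have := (Commute.conj_iff (A k)).2 h2
    simpa [mul_assoc] using this
  rw [commutatorElement_def]
  exact (h3.mul_left (hPP 0 l).inv_left).symm

include hAZ hPZ hAP in
/-- A second expression for `⁅A k, P 0⁆`, in which the index `k` has moved from `A` to `P`. -/
theorem commutator_inv_inv_eq (hPp : P 0 ^ p = 1)
    (hc : ∀ k j, (p : ℤ) ∣ c 0 k j - Pi.single (M := fun _ => ℤ) k 1 j) (k : Fin a) :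
    ⁅(A 0)⁻¹, (P k)⁻¹⁆ = ⁅A k, P 0⁆ := by
  rcases eq_or_ne k 0 with rfl | hk
  · have h1 : ⁅(A 0)⁻¹, (P 0)⁻¹⁆ = (P 0 * A 0)⁻¹ * ⁅A 0, P 0⁆ * (P 0 * A 0) := by
      simp only [commutatorElement_def]; group
    rw [h1, mul_assoc, ((hPZ 0).mul_left (hAZ 0)).symm.eq, inv_mul_cancel_left]
  · rw [hAP 0 k hk]
    exact prodPow_eq_of_dvd_sub_single (commutator_pow_eq_one hPp hPZ) k (hc k)

include hPP hAZ hPZ hAP in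
/-- The conjugates of the `(P k)⁻¹` by `(A 0)⁻¹` are `⁅A k, P 0⁆ * (P k)⁻¹`, and they commute. -/
theorem commute_commutator_commutator (hPp : P 0 ^ p = 1)
    (hc : ∀ k j, (p : ℤ) ∣ c 0 k j - Pi.single (M := fun _ => ℤ) k 1 j) (k l : Fin a) :
    Commute ⁅A k, P 0⁆ ⁅A l, P 0⁆ := by
  have hPZ' := commute_commutator_of_center_relations hPP hPZ hAP
  have h1 : ∀ k, (A 0)⁻¹ * (P k)⁻¹ * (A 0)⁻¹⁻¹ = ⁅A k, P 0⁆ * (P k)⁻¹ := fun k => by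
    rw [← commutator_inv_inv_eq hAZ hPZ hAP hPp hc k, commutatorElement_def]; group
  have h2 : Commute (⁅A k, P 0⁆ * (P k)⁻¹) (⁅A l, P 0⁆ * (P l)⁻¹) := by
    rw [← h1, ← h1]
    exact (Commute.conj_iff _).2 (hPP k l).inv_inv
  have h3 : Commute (⁅A k, P 0⁆ * (P k)⁻¹ * P k) (⁅A l, P 0⁆ * (P l)⁻¹) :=
    h2.mul_left ((hPZ' k l).mul_right (hPP k l).inv_right)
  have h4 := h3.mul_right
    (((hPZ' l k).symm.mul_left ((hPP k l).inv_left)).mul_left (hPP k l))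
  simpa using h4

include hPP hAZ hPZ hAP in
/-- Write `⁅A k, P 0⁆` as `⁅(A 0)⁻¹, (P k)⁻¹⁆`. Then `A l` fixes the first entry and multiplies the
second by an element commuting with both `A 0` and `P k`. -/
theorem commute_commutator_of_heisenberg_relations (hAA : ∀ k l, Commute (A k) (A l))
    (hPp : P 0 ^ p = 1)
    (hc : ∀ k j, (p : ℤ) ∣ c 0 k j - Pi.single (M := fun _ => ℤ) k 1 j) (l k : Fin a) :
    Commute (A l) ⁅A k, P 0⁆ := by
  have hPZ' := commute_commutator_of_center_relations hPP hPZ hAP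
  have key := commutator_inv_inv_eq hAZ hPZ hAP hPp hc
  have hinv : ∀ g h : G, ⁅g, h⁆ = ⁅h, g⁆⁻¹ := fun g h => (commutatorElement_inv h g).symm
  rw [← key k, hinv, Commute.inv_right_iff]
  -- The formula for `⁅(A l)⁻¹, (P k)⁻¹⁆` is not assumed for `k = 0`, but then `⁅A l, P 0⁆` is known
  -- to commute with `A 0` and `P 0`.
  rcases eq_or_ne k 0 with rfl | hk
  · refine commute_commutator_of_conj_eq_mul_left (m := ⁅A l, P 0⁆⁻¹) (hAA l 0).inv_right
      ?_ (hAZ l).inv_inv.symm ?_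
    · have h1 : A l * (P 0)⁻¹ * (A l)⁻¹ = (⁅A l, P 0⁆ * P 0)⁻¹ := by
        simp only [commutatorElement_def]; group
      rw [h1, ← (hPZ l).eq, mul_inv_rev]
    · rw [hinv (P 0)⁻¹, key]
      exact (commute_commutator_commutator hPP hAZ hPZ hAP hPp hc l 0).inv_inv
  · rw [← Commute.inv_left_iff]
    refine commute_commutator_of_conj_eq_mul_left (m := ⁅(A l)⁻¹, (P k)⁻¹⁆)
      (hAA l 0).inv_inv ?_ ?_ ?_
    · simp only [commutatorElement_def]; group
    · rw [hAP l k hk]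
      exact (commute_prodPow (fun s => (hAZ s).inv_left) _).symm
    · rw [hAP l k hk, hinv (P k)⁻¹, key, Commute.inv_right_iff]
      exact (commute_prodPow
        (fun s => commute_commutator_commutator hPP hAZ hPZ hAP hPp hc k s) _).symm

end Heisenberg

/-! ### Orders of central extensions -/

section OrderBound

variable {G : Type*} [Group G]

/-- A subgroup `N` is normal if it is central modulo a normal subgroup `L` it contains. -/
theorem normal_sup_of_central_mod {L : Subgroup G} [L.Normal] {T S : Set G}
    (hT : Subgroup.closure T = ⊤)
    (h : ∀ g ∈ T, ∀ s ∈ S, Commute (g : G ⧸ L) (s : G ⧸ L)) :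
    (Subgroup.closure S ⊔ L).Normal := by
  have hle : Subgroup.closure S ⊔ L ≤ (Subgroup.center (G ⧸ L)).comap (QuotientGroup.mk' L) := by
    refine sup_le ((Subgroup.closure_le _).2 fun s hs => ?_) fun x hx => ?_
    · have h1 : (⊤ : Subgroup G) ≤
          (Subgroup.centralizer {(s : G ⧸ L)}).comap (QuotientGroup.mk' L) := by
        rw [← hT, Subgroup.closure_le]
        intro g hg
        exact Subgroup.mem_centralizer_singleton_iff.2 (h g hg s hs)
      refine Subgroup.mem_center_iff.2 fun g => ?_
      obtain ⟨g, rfl⟩ := QuotientGroup.mk_surjective g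
      exact Subgroup.mem_centralizer_singleton_iff.1 (h1 (Subgroup.mem_top g))
    · rw [Subgroup.mem_comap, QuotientGroup.mk'_apply, (QuotientGroup.eq_one_iff x).2 hx]
      exact one_mem _
  refine ⟨fun n hn g => ?_⟩
  have h2 : g * n * g⁻¹ * n⁻¹ ∈ L := by
    rw [← QuotientGroup.eq_one_iff]
    have := Subgroup.mem_center_iff.1 (hle hn) g
    simp only [QuotientGroup.mk'_apply] at this
    simp [this]
  simpa using mul_mem (Subgroup.mem_sup_right (S := Subgroup.closure S) h2) hn

theorem finite_and_card_sup_le {H N : Subgroup G} [N.Normal] [Finite H] [Finite N] :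
    Finite ↥(H ⊔ N) ∧ Nat.card ↥(H ⊔ N) ≤ Nat.card H * Nat.card N := by
  let f : H × N → ↥(H ⊔ N) := fun x =>
    ⟨x.1 * x.2, mul_mem (Subgroup.mem_sup_left x.1.2) (Subgroup.mem_sup_right x.2.2)⟩
  have hf : Function.Surjective f := by
    rintro ⟨x, hx⟩
    have hx' : x ∈ (↑(H ⊔ N) : Set G) := hx
    rw [Subgroup.mul_normal] at hx'
    obtain ⟨h, hh, n, hn, rfl⟩ := hx'
    exact ⟨(⟨h, hh⟩, ⟨n, hn⟩), rfl⟩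
  exact ⟨Finite.of_surjective f hf, (Nat.card_le_card_of_surjective f hf).trans_eq
    (Nat.card_prod _ _)⟩

theorem finite_and_card_closure_le {p a : ℕ} (hp : p ≠ 0) {g : Fin a → G}
    (hc : ∀ k l, Commute (g k) (g l)) (hg : ∀ k, g k ^ p = 1) :
    Finite (Subgroup.closure (Set.range g)) ∧
      Nat.card (Subgroup.closure (Set.range g)) ≤ p ^ a := by
  have hcomm : ∀ x ∈ Set.range g, ∀ y ∈ Set.range g, x * y = y * x := by
    rintro _ ⟨k, rfl⟩ _ ⟨l, rfl⟩; exact hc k l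
  let _ : CommGroup (Subgroup.closure (Set.range g)) :=
    { (inferInstance : Group (Subgroup.closure (Set.range g))) with
      mul_comm := (Subgroup.isMulCommutative_closure hcomm).is_comm.comm }
  have hpow : ∀ x : Subgroup.closure (Set.range g), x ^ p = 1 := by
    have : Subgroup.closure (Set.range g) ≤
        (powMonoidHom p : Subgroup.closure (Set.range g) →* _).ker.map
          (Subgroup.closure (Set.range g)).subtype := by
      rw [Subgroup.closure_le]
      rintro _ ⟨k, rfl⟩
      exact ⟨⟨g k, Subgroup.subset_closure ⟨k, rfl⟩⟩, Subtype.ext (hg k), rfl⟩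
    rintro ⟨x, hx⟩
    obtain ⟨y, hy, rfl⟩ := this hx
    exact hy
  have hrank := Subgroup.rank_closure_finite_le_nat_card (Set.range g)
  have hdvd := card_dvd_exponent_pow_rank' (Subgroup.closure (Set.range g)) hpow
  have hle : Nat.card (Set.range g) ≤ a := by
    simpa using Finite.card_range_le g
  refine ⟨Nat.finite_of_card_ne_zero fun h0 => ?_, ?_⟩
  · rw [h0, zero_dvd_iff] at hdvd
    exact pow_ne_zero _ hp hdvd
  · exact (Nat.le_of_dvd (pow_pos (Nat.pos_of_ne_zero hp) _) hdvd).trans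
      (Nat.pow_le_pow_right (Nat.pos_of_ne_zero hp) (hrank.trans hle))

end OrderBound

/-! ### The order of a group satisfying the relations -/

section OrderBound

variable {G : Type*} [Group G]

theorem commute_of_mem_closure {x y : G} {S : Set G} (h : ∀ s ∈ S, Commute x s)
    (hy : y ∈ Subgroup.closure S) : Commute x y := by
  have hle : Subgroup.closure S ≤ Subgroup.centralizer {x} := (Subgroup.closure_le _).2
    fun s hs => Subgroup.mem_centralizer_singleton_iff.2 (h s hs).symm.eq
  exact (show Commute y x from Subgroup.mem_centralizer_singleton_iff.1 (hle hy)).symm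

/-- The order of a group satisfying the relations, freed of the words: `P k` plays the role of
`x_{α+β}(v_k)`, and `⁅A k, P 0⁆` that of `x_{2α+β}(2 v_k)`. -/
theorem finite_and_card_le_of_relations {p a : ℕ} [NeZero a] (hp : p ≠ 0) {A B P : Fin a → G}
    {c : Fin a → Fin a → Fin a → ℤ}
    (hgen : Subgroup.closure (Set.range A ∪ Set.range B) = ⊤)
    (hAp : ∀ k, A k ^ p = 1) (hBp : ∀ k, B k ^ p = 1) (hPp : ∀ k, P k ^ p = 1)
    (hAA : ∀ k l, Commute (A k) (A l)) (hBB : ∀ k l, Commute (B k) (B l))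
    (hPP : ∀ k l, Commute (P k) (P l))
    (hAZ : ∀ k, Commute (A 0) ⁅A k, P 0⁆) (hPZ : ∀ k, Commute (P 0) ⁅A k, P 0⁆)
    (hAP : ∀ k l, l ≠ 0 → ⁅(A k)⁻¹, (P l)⁻¹⁆ = prodPow (fun s => ⁅A s, P 0⁆) (c k l))
    (hc : ∀ k j, (p : ℤ) ∣ c 0 k j - Pi.single (M := fun _ => ℤ) k 1 j)
    (hPB : ∀ i, Commute (P 0) (B i)) (hPB' : ∀ i, Commute (P i) (B 0))
    (hBA : ∀ i, ∃ z ∈ Subgroup.closure (Set.range fun k => ⁅A k, P 0⁆), ⁅B 0, A i⁆ = P i * z)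
    (hAB : ∀ i j, ∃ y ∈ Subgroup.closure (Set.range P),
      ∃ z ∈ Subgroup.closure (Set.range fun k => ⁅A k, P 0⁆), ⁅(A j)⁻¹, (B i)⁻¹⁆ = y * z) :
    Finite G ∧ Nat.card G ≤ p ^ (4 * a) := by
  set Z : Fin a → G := fun k => ⁅A k, P 0⁆ with hZ
  have hZp : ∀ k, Z k ^ p = 1 := commutator_pow_eq_one (hPp 0) hPZ
  have hPZ' : ∀ l k, Commute (P l) (Z k) := commute_commutator_of_center_relations hPP hPZ hAP
  have hZZ : ∀ k l, Commute (Z k) (Z l) :=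
    commute_commutator_commutator hPP hAZ hPZ hAP (hPp 0) hc
  have hAZ' : ∀ l k, Commute (A l) (Z k) :=
    commute_commutator_of_heisenberg_relations hPP hAZ hPZ hAP hAA (hPp 0) hc
  have hcl : ∀ {x : G} {g : Fin a → G}, (∀ k, Commute x (g k)) →
      ∀ z ∈ Subgroup.closure (Set.range g), Commute x z := fun h z hz =>
    commute_of_mem_closure (by rintro _ ⟨k, rfl⟩; exact h k) hz
  have hBA' : ∀ i j, (B i)⁻¹ * A j * (B i)⁻¹⁻¹ = A j * ⁅(A j)⁻¹, (B i)⁻¹⁆ := fun i j => by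
    simp only [commutatorElement_def]; group
  -- `B i` fixes `P 0` and moves `A k` by an element commuting with `P 0`, so it fixes `Z k`.
  have hBZ : ∀ i k, Commute (B i) (Z k) := fun i k => by
    rw [← Commute.inv_left_iff]
    refine commute_commutator_of_conj_eq_mul_right (hPB i).symm.inv_left (hBA' i k) ?_
    obtain ⟨y, hy, z, hz, h⟩ := hAB i k
    rw [h]
    exact ((hcl (hPP 0) y hy).mul_right (hcl hPZ z hz)).symm
  -- `P k` is `⁅B 0, A k⁆` up to a central element, and the same argument applies to it.
  have hBP : ∀ i k, Commute (B i) (P k) := fun i k => by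
    obtain ⟨z, hz, h⟩ := hBA k
    have h1 : Commute (B i)⁻¹ ⁅A k, B 0⁆ := by
      refine commute_commutator_of_conj_eq_mul_right (hBB i 0).inv_left (hBA' i k) ?_
      obtain ⟨y, hy, z, hz, h⟩ := hAB i k
      rw [h]
      exact ((hcl (fun l => (hPB' l).symm) y hy).mul_right (hcl (hBZ 0) z hz)).symm
    have h2 : Commute (B i) ⁅B 0, A k⁆ := by
      rw [← commutatorElement_inv]
      exact (Commute.inv_left_iff.1 h1).inv_right
    rw [eq_mul_inv_of_mul_eq h.symm]
    exact h2.mul_right (hcl (hBZ i) z hz).inv_right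
  -- The factors of the normal series `⟨Z⟩ ≤ ⟨P, Z⟩ ≤ ⟨B, P, Z⟩ ≤ ⟨A, B, P, Z⟩` have order at most
  -- `p ^ a`.
  set N₁ := Subgroup.closure (Set.range Z) with hN₁
  set N₂ := Subgroup.closure (Set.range P) ⊔ N₁ with hN₂
  set N₃ := Subgroup.closure (Set.range B) ⊔ N₂ with hN₃
  have hmk : ∀ {L : Subgroup G} [L.Normal] {x y : G}, ⁅x, y⁆ ∈ L →
      Commute (x : G ⧸ L) (y : G ⧸ L) := fun {L} _ {x y} h => by
    rw [← commutatorElement_eq_one_iff_commute]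
    exact (QuotientGroup.eq_one_iff _).2 h
  have hmk' : ∀ {L : Subgroup G} [L.Normal] {x y : G}, ⁅x⁻¹, y⁻¹⁆ ∈ L →
      Commute (x : G ⧸ L) (y : G ⧸ L) := fun {L} _ {x y} h => by
    simpa using hmk h
  have hmap : ∀ {L : Subgroup G} [L.Normal] {x y : G}, Commute x y →
      Commute (x : G ⧸ L) (y : G ⧸ L) := fun {L} _ {x y} h => h.map (QuotientGroup.mk' L)
  have i₁ : N₁.Normal := by
    have := normal_sup_of_central_mod (L := ⊥) hgen (S := Set.range Z) (by
      rintro _ (⟨k, rfl⟩ | ⟨k, rfl⟩) _ ⟨l, rfl⟩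
      · exact hmap (hAZ' k l)
      · exact hmap (hBZ k l))
    rwa [sup_bot_eq] at this
  have i₂ : N₂.Normal := by
    refine normal_sup_of_central_mod (L := N₁) hgen ?_
    rintro _ (⟨k, rfl⟩ | ⟨k, rfl⟩) _ ⟨l, rfl⟩
    · rcases eq_or_ne l 0 with rfl | hl
      · exact hmk (Subgroup.subset_closure (Set.mem_range_self k))
      · refine hmk' ?_
        rw [hAP k l hl]
        exact prodPow_mem (fun s => Subgroup.subset_closure (Set.mem_range_self s)) _
    · exact hmap (hBP k l)
  have i₃ : N₃.Normal := by
    refine normal_sup_of_central_mod (L := N₂) hgen ?_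
    rintro _ (⟨k, rfl⟩ | ⟨k, rfl⟩) _ ⟨l, rfl⟩
    · refine hmk' ?_
      obtain ⟨y, hy, z, hz, h⟩ := hAB l k
      rw [h]
      exact mul_mem (Subgroup.mem_sup_left hy) (Subgroup.mem_sup_right hz)
    · exact hmap (hBB k l)
  have htop : Subgroup.closure (Set.range A) ⊔ N₃ = ⊤ := by
    rw [eq_top_iff, ← hgen, Subgroup.closure_union]
    exact sup_le_sup_left le_sup_left _
  obtain ⟨fA, cA⟩ := finite_and_card_closure_le hp hAA hAp
  obtain ⟨fB, cB⟩ := finite_and_card_closure_le hp hBB hBp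
  obtain ⟨fP, cP⟩ := finite_and_card_closure_le hp hPP hPp
  obtain ⟨f₁, c₁⟩ := finite_and_card_closure_le hp hZZ hZp
  obtain ⟨f₂, c₂⟩ := finite_and_card_sup_le (H := Subgroup.closure (Set.range P)) (N := N₁)
  obtain ⟨f₃, c₃⟩ := finite_and_card_sup_le (H := Subgroup.closure (Set.range B)) (N := N₂)
  obtain ⟨f₄, c₄⟩ := finite_and_card_sup_le (H := Subgroup.closure (Set.range A)) (N := N₃)
  rw [htop] at f₄ c₄
  rw [Subgroup.card_top] at c₄
  refine ⟨Finite.of_equiv _ Subgroup.topEquiv.toEquiv, c₄.trans ?_⟩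
  calc _ ≤ p ^ a * (p ^ a * (p ^ a * p ^ a)) :=
        Nat.mul_le_mul cA (c₃.trans (Nat.mul_le_mul cB (c₂.trans (Nat.mul_le_mul cP c₁))))
    _ = p ^ (4 * a) := by ring

end OrderBound

/-! ### The relations hold for the root elements -/

section RootElements

variable {F : Type*} [Field F] {G : Type*} [Group G]

/-- The Steinberg relations between the positive root elements of type `C₂`, for a family
`x γ t` in an arbitrary group. -/
structure IsRootFamily (x : PosRoot → F → G) : Prop where
  add : ∀ γ s t, x γ (s + t) = x γ s * x γ t
  commutator_β_α : ∀ t s, ⁅x .β t, x .α s⁆ = x .αβ (t * s) * x .ααβ (t * s ^ 2)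
  commutator_α_αβ : ∀ s t, ⁅x .α s, x .αβ t⁆ = x .ααβ (2 * s * t)
  commute_β_αβ : ∀ s t, Commute (x .β s) (x .αβ t)
  commute_ααβ : ∀ γ s t, Commute (x γ s) (x .ααβ t)

namespace IsRootFamily

variable {x : PosRoot → F → G} (hx : IsRootFamily x)

include hx

/-- A root subgroup as the range of a homomorphism. -/
theorem exists_hom (γ : PosRoot) :
    ∃ φ : Multiplicative F →* G, ∀ t, φ (.ofAdd t) = x γ t :=
  ⟨MonoidHom.mk' (fun t => x γ t.toAdd) fun s t => hx.add γ s.toAdd t.toAdd, fun _ => rfl⟩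

theorem zero (γ : PosRoot) : x γ 0 = 1 := by
  obtain ⟨φ, h⟩ := hx.exists_hom γ
  rw [← h, ofAdd_zero, map_one]

theorem neg (γ : PosRoot) (t : F) : x γ (-t) = (x γ t)⁻¹ := by
  obtain ⟨φ, h⟩ := hx.exists_hom γ
  rw [← h, ← h, ofAdd_neg, map_inv]

theorem prodPow_eq {a : ℕ} (γ : PosRoot) (v : Fin a → F) (n : Fin a → ℤ) :
    prodPow (fun k => x γ (v k)) n = x γ (∑ k, (n k : F) * v k) := by
  obtain ⟨φ, h⟩ := hx.exists_hom γ
  simp only [← h]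
  rw [← map_prodPow, ofAdd_sum, prodPow, List.prod_ofFn]
  simp [← ofAdd_zsmul, zsmul_eq_mul]

theorem pow_eq_one {p : ℕ} [CharP F p] (γ : PosRoot) (t : F) : x γ t ^ p = 1 := by
  obtain ⟨φ, h⟩ := hx.exists_hom γ
  rw [← h, ← map_pow, ← ofAdd_nsmul, nsmul_eq_mul, CharP.cast_eq_zero, zero_mul, ofAdd_zero,
    map_one]

theorem commute_self (γ : PosRoot) (s t : F) : Commute (x γ s) (x γ t) := by
  rw [commute_iff_eq, ← hx.add, add_comm, hx.add]

theorem commutator_α_mul (s t u : F) :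
    ⁅x .α s, x .αβ t * x .ααβ u⁆ = x .ααβ (2 * s * t) := by
  have h : ⁅x .α s, x .αβ t * x .ααβ u⁆ =
      ⁅x .α s, x .αβ t⁆ * (x .αβ t * ⁅x .α s, x .ααβ u⁆ * (x .αβ t)⁻¹) := by
    simp only [commutatorElement_def]; group
  rw [h, commutatorElement_eq_one_iff_commute.2 (hx.commute_ααβ _ _ _), hx.commutator_α_αβ]
  simp

section Words

variable {a : ℕ} [NeZero a] {v : Fin a → F} (K : Exponents v)

omit [NeZero a] in
theorem halfα_eq (i : Fin a) : halfα K (fun k => x .α (v k)) i = x .α (v i / 2) := by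
  rw [halfα, hx.prodPow_eq, K.m_spec]

theorem wordαβ_eq (h2 : (2 : F) ≠ 0) (hv : v 0 = 1) (i : Fin a) :
    wordαβ K (fun k => x .α (v k)) (fun k => x .β (v k)) i = x .αβ (v i) := by
  have h1 : ∀ k, ⁅x .α (v k / 2), ⁅x .β 1, x .α 1⁆⁆ = x .ααβ (v k) := fun k => by
    rw [hx.commutator_β_α, hx.commutator_α_mul, mul_div_cancel₀ _ h2, mul_one, mul_one]
  simp only [wordαβ, hx.halfα_eq, hv, h1]
  rw [hx.prodPow_eq, K.r_spec, hx.commutator_β_α, mul_assoc, ← hx.add]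
  simp [hx.zero]

theorem wordααβ_eq (h2 : (2 : F) ≠ 0) (hv : v 0 = 1) (i : Fin a) :
    wordααβ K (fun k => x .α (v k)) (fun k => x .β (v k)) i = x .ααβ (v i) := by
  rw [wordααβ, hx.halfα_eq, hx.wordαβ_eq K h2 hv, hv, hx.commutator_α_αβ,
    mul_div_cancel₀ _ h2, mul_one]

theorem relLHS_eq_relRHS {p : ℕ} [CharP F p] (h2 : (2 : F) ≠ 0) (hv : v 0 = 1)
    (ι : RelIndex a) :
    relLHS p K (fun k => x .α (v k)) (fun k => x .β (v k)) ι =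
      relRHS K (fun k => x .α (v k)) (fun k => x .β (v k)) ι := by
  have hP := hx.wordαβ_eq K h2 hv
  have hQ := hx.wordααβ_eq K h2 hv
  have hPm : ∀ i j, wordαβMul K (fun k => x .α (v k)) (fun k => x .β (v k)) i j =
      x .αβ (v i * v j) := fun i j => by
    rw [wordαβMul, funext hP, hx.prodPow_eq, K.d_spec]
  have hQm : ∀ i j, wordααβMulSq K (fun k => x .α (v k)) (fun k => x .β (v k)) i j =
      x .ααβ (v i * v j ^ 2) := fun i j => by
    rw [wordααβMulSq, funext hQ, hx.prodPow_eq, K.f_spec]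
  cases ι <;> simp only [relLHS, relRHS, hP, hQm, hPm, hv,
    commutatorElement_eq_one_iff_commute, hx.pow_eq_one, hx.commute_self, hx.commutator_α_αβ,
    hx.commute_ααβ]
  case C6 k k' h =>
    have h1 : ∀ s, x .ααβ (2 * v s * 1) = x .ααβ ((fun s => 2 * v s) s) := fun s => by simp
    rw [← hx.neg, ← hx.neg, hx.commutator_α_αβ, funext h1, hx.prodPow_eq]
    congr 1
    simp only [mul_left_comm _ (2 : F), ← Finset.mul_sum, K.c_spec]
    ring
  case C7 i => exact (hx.commute_β_αβ _ _).symm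
  case C8 i => exact (hx.commute_β_αβ _ _).symm
  case C9 i =>
    rw [funext hQ, hx.prodPow_eq, K.r_spec, one_mul, ← hx.neg]
  case C10 i => rw [hx.commutator_β_α, one_mul, one_mul]
  case C11 i j =>
    rw [← hx.neg, ← hx.neg, ← commutatorElement_inv, hx.commutator_β_α, mul_inv_rev, ← hx.neg,
      ← hx.neg, ← hx.neg, (hx.commute_ααβ _ _ _).eq]
    congr 2 <;> ring

end Words

end IsRootFamily

variable (F) in
theorem isRootFamily_rootElement : IsRootFamily (rootElement (F := F)) := by
  have hcomm : ∀ {g h z : Matrix.symplecticGroup (Fin 2) F}, g * h = z * (h * g) → ⁅g, h⁆ = z :=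
    fun {g h z} e => by rw [commutatorElement_def, e]; group
  refine ⟨fun γ s t => Subtype.ext ?_, fun t s => hcomm (Subtype.ext ?_),
    fun s t => hcomm (Subtype.ext ?_), fun s t => Subtype.ext ?_, fun γ s t => Subtype.ext ?_⟩
  · cases γ <;> simp [rootElement, rootMatrix, Matrix.fromBlocks_multiply, Matrix.one_fin_two,
      add_comm]
  · simp [rootElement, rootMatrix, Matrix.fromBlocks_multiply, Matrix.one_fin_two]
    ring_nf
    exact funext fun i => by fin_cases i <;> rfl
  · simp [rootElement, rootMatrix, Matrix.fromBlocks_multiply, Matrix.one_fin_two]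
    ring_nf
  · simp [rootElement, rootMatrix, Matrix.fromBlocks_multiply, Matrix.one_fin_two]
  · cases γ <;> simp [rootElement, rootMatrix, Matrix.fromBlocks_multiply, Matrix.one_fin_two,
      add_comm]

end RootElements

/-! ### The unipotent radical as a Sylow subgroup -/

section Unipotent

open Matrix

variable {F : Type*} [Field F]

theorem mulVec_inv_mulVec (g : symplecticGroup (Fin 2) F) (w : Fin 2 ⊕ Fin 2 → F) :
    (g⁻¹ : symplecticGroup (Fin 2) F).1 *ᵥ (g.1 *ᵥ w) = w := by
  rw [mulVec_mulVec, ← Submonoid.coe_mul, inv_mul_cancel, Submonoid.coe_one, one_mulVec]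

/-- The standard basis vector `e₁` or `e₂` of the Lagrangian subspace spanned by the first block
of coordinates. -/
abbrev lagrangeVec (i : Fin 2) : Fin 2 ⊕ Fin 2 → F := Pi.single (Sum.inl i) 1

variable (F) in
/-- The unipotent radical of the stabilizer of the flag `⟨e₁⟩ < ⟨e₁, e₂⟩` in `Sp₄(F)`. A symplectic
matrix acting trivially on the two factors of this flag also does so on the two dual ones, so no
condition is needed on the second block of coordinates. -/
def unipotentRadical : Subgroup (symplecticGroup (Fin 2) F) where
  carrier := {g | g.1 *ᵥ lagrangeVec 0 = lagrangeVec 0 ∧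
    ∃ s : F, g.1 *ᵥ lagrangeVec 1 = s • lagrangeVec 0 + lagrangeVec 1}
  one_mem' := ⟨by rw [Submonoid.coe_one, one_mulVec], 0, by
    rw [Submonoid.coe_one, one_mulVec, zero_smul, zero_add]⟩
  mul_mem' := by
    rintro g h ⟨hg, s, hs⟩ ⟨hh, t, ht⟩
    refine ⟨?_, t + s, ?_⟩
    · rw [Submonoid.coe_mul, ← mulVec_mulVec, hh, hg]
    · rw [Submonoid.coe_mul, ← mulVec_mulVec, ht, mulVec_add, mulVec_smul, hg, hs, add_smul,
        add_assoc]
  inv_mem' := by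
    rintro g ⟨hg, s, hs⟩
    have h0 : (g⁻¹ : symplecticGroup (Fin 2) F).1 *ᵥ lagrangeVec 0 = lagrangeVec 0 := by
      conv_lhs => rw [← hg, mulVec_inv_mulVec]
    refine ⟨h0, -s, ?_⟩
    have h1 : (lagrangeVec 1 : Fin 2 ⊕ Fin 2 → F) = g.1 *ᵥ lagrangeVec 1 - s • lagrangeVec 0 := by
      rw [hs, add_sub_cancel_left]
    conv_lhs => rw [h1, mulVec_sub, mulVec_inv_mulVec, mulVec_smul, h0]
    rw [neg_smul, neg_add_eq_sub]

theorem mem_unipotentRadical {g : symplecticGroup (Fin 2) F} :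
    g ∈ unipotentRadical F ↔ g.1 *ᵥ lagrangeVec 0 = lagrangeVec 0 ∧
      ∃ s : F, g.1 *ᵥ lagrangeVec 1 = s • lagrangeVec 0 + lagrangeVec 1 := Iff.rfl

theorem rootElement_mem (γ : PosRoot) (t : F) : rootElement γ t ∈ unipotentRadical F := by
  rw [mem_unipotentRadical]
  have h0 : (rootElement γ t).1 *ᵥ lagrangeVec 0 = lagrangeVec 0 := by
    funext i
    rcases i with i | i <;> fin_cases i <;> cases γ <;> simp [rootElement, rootMatrix]
  refine ⟨h0, (rootElement γ t).1 (.inl 0) (.inl 1), ?_⟩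
  funext i
  rcases i with i | i <;> fin_cases i <;> cases γ <;> simp [rootElement, rootMatrix]

variable (F) in
theorem isRootFamily_unipotentRadical : IsRootFamily fun (γ : PosRoot) (t : F) =>
    (⟨rootElement γ t, rootElement_mem γ t⟩ : unipotentRadical F) where
  add γ s t := Subtype.ext ((isRootFamily_rootElement F).add γ s t)
  commutator_β_α t s := Subtype.ext ((isRootFamily_rootElement F).commutator_β_α t s)
  commutator_α_αβ s t := Subtype.ext ((isRootFamily_rootElement F).commutator_α_αβ s t)
  commute_β_αβ s t := Subtype.ext ((isRootFamily_rootElement F).commute_β_αβ s t)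
  commute_ααβ γ s t := Subtype.ext ((isRootFamily_rootElement F).commute_ααβ γ s t)

/-- The general element of the unipotent radical as a matrix. -/
theorem coe_prod_rootElement (s t u w : F) :
    (rootElement .α s * rootElement .β t * rootElement .αβ u * rootElement .ααβ w).1 =
      fromBlocks !![1, s; 0, 1] !![w + s * u, u - s * t; u, -t] 0 !![1, 0; -s, 1] := by
  simp [rootElement, rootMatrix, fromBlocks_multiply, one_fin_two, sub_eq_add_neg, add_comm]

theorem exists_eq_prod_rootElement {g : symplecticGroup (Fin 2) F}
    (hg : g ∈ unipotentRadical F) : ∃ s t u w : F,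
      g = rootElement .α s * rootElement .β t * rootElement .αβ u * rootElement .ααβ w := by
  obtain ⟨h0, s, h1⟩ := hg
  -- After division by `x_α(s)` the element fixes `e₁` and `e₂`.
  obtain ⟨h, rfl⟩ : ∃ h, g = rootElement .α s * h := ⟨(rootElement .α s)⁻¹ * g, by simp⟩
  have hα0 : (rootElement .α s).1 *ᵥ lagrangeVec 0 = lagrangeVec 0 := (rootElement_mem _ _).1
  have hα1 : (rootElement .α s).1 *ᵥ lagrangeVec 1 = s • lagrangeVec 0 + lagrangeVec 1 := by
    funext i
    rcases i with i | i <;> fin_cases i <;> simp [rootElement, rootMatrix]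
  have hcancel : ∀ {w w' : Fin 2 ⊕ Fin 2 → F}, (rootElement .α s * h).1 *ᵥ w =
      (rootElement .α s).1 *ᵥ w' → h.1 *ᵥ w = w' := fun {w w'} e => by
    rw [← mulVec_inv_mulVec (rootElement .α s) w', ← e, Submonoid.coe_mul, ← mulVec_mulVec,
      mulVec_inv_mulVec]
  replace h0 := hcancel (h0.trans hα0.symm)
  replace h1 := hcancel (h1.trans hα1.symm)
  obtain ⟨A, B, C, D, hM⟩ : ∃ A B C D, h.1 = fromBlocks A B C D :=
    ⟨_, _, _, _, (fromBlocks_toBlocks h.1).symm⟩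
  rw [mulVec_single_one, hM] at h0 h1
  have hA : A = 1 := by
    ext i j
    fin_cases j
    · simpa [Pi.single_apply, one_apply] using congrFun h0 (.inl i)
    · simpa [Pi.single_apply, one_apply] using congrFun h1 (.inl i)
  have hC : C = 0 := by
    ext i j
    fin_cases j
    · simpa using congrFun h0 (.inr i)
    · simpa using congrFun h1 (.inr i)
  have hS := h.2
  rw [hM, SymplecticGroup.fromBlocks_mem_iff, hA, hC] at hS
  obtain ⟨-, hB, hD⟩ := hS
  have hD' : D = 1 := by simpa using hD
  have hB' : B 1 0 = B 0 1 := by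
    have := congrFun (congrFun hB 0) 1
    simpa [hD'] using this
  refine ⟨s, -B 1 1, B 0 1, B 0 0, ?_⟩
  rw [mul_assoc, mul_assoc, ← mul_assoc (rootElement .β _)]
  congr 1
  refine Subtype.ext ?_
  have h2 := coe_prod_rootElement 0 (-B 1 1) (B 0 1) (B 0 0)
  rw [(isRootFamily_rootElement F).zero, one_mul] at h2
  rw [h2, hM, hA, hC, hD', eta_fin_two B, hB']
  simp [one_fin_two]

variable (F) in
theorem card_unipotentRadical : Nat.card (unipotentRadical F) = Nat.card F ^ 4 := by
  let f : F × F × F × F → unipotentRadical F := fun x =>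
    ⟨rootElement .α x.1 * rootElement .β x.2.1 * rootElement .αβ x.2.2.1 *
      rootElement .ααβ x.2.2.2, mul_mem (mul_mem (mul_mem (rootElement_mem _ _)
        (rootElement_mem _ _)) (rootElement_mem _ _)) (rootElement_mem _ _)⟩
  have hf : Function.Bijective f := by
    constructor
    · rintro ⟨s, t, u, w⟩ ⟨s', t', u', w'⟩ h
      have h1 := congrArg (fun g => g.1.1) h
      simp only [f, coe_prod_rootElement, fromBlocks_inj] at h1
      obtain ⟨h1, h2, -, -⟩ := h1
      have e1 : s = s' := by simpa using congrFun (congrFun h1 0) 1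
      have e2 : t = t' := by simpa using congrFun (congrFun h2 1) 1
      have e3 : u = u' := by simpa using congrFun (congrFun h2 1) 0
      have e4 : w = w' := by simpa [e1, e3] using congrFun (congrFun h2 0) 0
      rw [e1, e2, e3, e4]
    · rintro ⟨g, hg⟩
      obtain ⟨s, t, u, w, rfl⟩ := exists_eq_prod_rootElement hg
      exact ⟨(s, t, u, w), rfl⟩
  rw [← Nat.card_congr (Equiv.ofBijective f hf), Nat.card_prod, Nat.card_prod, Nat.card_prod]
  ring

theorem eq_one_of_pow_char_pow_eq_one {p : ℕ} [Fact p.Prime] [CharP F p] {c : F} {k : ℕ}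
    (h : c ^ p ^ k = 1) : c = 1 := by
  have h1 : (c - 1) ^ p ^ k = 0 := by rw [sub_pow_char_pow, h, one_pow, sub_self]
  exact sub_eq_zero.1 ((pow_eq_zero_iff (pow_ne_zero k (Fact.out : p.Prime).ne_zero)).1 h1)

/-- The vectors fixed by the unipotent radical are the multiples of `e₁`, and those it moves by
multiples of `e₁` lie in `⟨e₁, e₂⟩`; so an element normalizing it stabilizes the flag
`⟨e₁⟩ < ⟨e₁, e₂⟩`, and if its order is a power of the characteristic, its eigenvalues
there are `1`. -/
theorem mem_unipotentRadical_of_normalizes {p : ℕ} [Fact p.Prime] [CharP F p]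
    {g : symplecticGroup (Fin 2) F} {k : ℕ} (hk : g ^ p ^ k = 1)
    (hg : ∀ u ∈ unipotentRadical F, g⁻¹ * u * g ∈ unipotentRadical F) :
    g ∈ unipotentRadical F := by
  have hconj : ∀ (u : symplecticGroup (Fin 2) F) (w : Fin 2 ⊕ Fin 2 → F),
      u.1 *ᵥ (g.1 *ᵥ w) = g.1 *ᵥ ((g⁻¹ * u * g).1 *ᵥ w) := fun u w => by
    simp only [mulVec_mulVec, ← Submonoid.coe_mul]
    congr 2
    group
  obtain ⟨c, hc⟩ : ∃ c : F, g.1 *ᵥ lagrangeVec 0 = c • lagrangeVec 0 := by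
    have h : ∀ γ, (rootElement γ 1).1 *ᵥ (g.1 *ᵥ lagrangeVec 0) = g.1 *ᵥ lagrangeVec 0 :=
      fun γ => by rw [hconj, (hg _ (rootElement_mem γ 1)).1]
    generalize g.1 *ᵥ lagrangeVec 0 = w at h
    have h1 : w (.inl 1) = 0 := by
      simpa [rootElement, rootMatrix, mulVec, dotProduct] using congrFun (h .α) (.inl 0)
    have h2 : w (.inr 0) = 0 := by
      simpa [rootElement, rootMatrix, mulVec, dotProduct, one_apply] using
        congrFun (h .ααβ) (.inl 0)
    have h3 : w (.inr 1) = 0 := by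
      simpa [rootElement, rootMatrix, mulVec, dotProduct, one_apply] using
        congrFun (h .β) (.inl 1)
    refine ⟨w (.inl 0), funext fun i => ?_⟩
    rcases i with i | i <;> fin_cases i <;> simp [h1, h2, h3]
  have hpow : ∀ n : ℕ, (g ^ n).1 *ᵥ lagrangeVec 0 = c ^ n • lagrangeVec 0 := fun n => by
    induction n with
    | zero => rw [pow_zero, pow_zero, Submonoid.coe_one, one_mulVec, one_smul]
    | succ n ih =>
      rw [pow_succ', Submonoid.coe_mul, ← mulVec_mulVec, ih, mulVec_smul, hc, smul_smul, pow_succ]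
  have hc1 : c = 1 := by
    have := congrFun (hpow (p ^ k)) (.inl 0)
    rw [hk] at this
    exact eq_one_of_pow_char_pow_eq_one (by simpa using this.symm)
  rw [hc1, one_smul] at hc
  obtain ⟨s, d, hd⟩ : ∃ s d : F, g.1 *ᵥ lagrangeVec 1 = s • lagrangeVec 0 + d • lagrangeVec 1 := by
    have h : ∀ γ, ∃ s : F, (rootElement γ 1).1 *ᵥ (g.1 *ᵥ lagrangeVec 1) =
        s • lagrangeVec 0 + g.1 *ᵥ lagrangeVec 1 := fun γ => by
      obtain ⟨s, hs⟩ := (hg _ (rootElement_mem γ 1)).2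
      exact ⟨s, by rw [hconj, hs, mulVec_add, mulVec_smul, hc]⟩
    generalize g.1 *ᵥ lagrangeVec 1 = w at h
    have h2 : w (.inr 0) = 0 := by
      obtain ⟨s, hs⟩ := h .αβ
      simpa [rootElement, rootMatrix, mulVec, dotProduct, one_apply] using congrFun hs (.inl 1)
    have h3 : w (.inr 1) = 0 := by
      obtain ⟨s, hs⟩ := h .β
      simpa [rootElement, rootMatrix, mulVec, dotProduct, one_apply] using congrFun hs (.inl 1)
    refine ⟨w (.inl 0), w (.inl 1), funext fun i => ?_⟩
    rcases i with i | i <;> fin_cases i <;> simp [h2, h3]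
  have hpow' : ∀ n : ℕ, ∃ s : F,
      (g ^ n).1 *ᵥ lagrangeVec 1 = s • lagrangeVec 0 + d ^ n • lagrangeVec 1 := fun n => by
    induction n with
    | zero =>
      exact ⟨0, by
        rw [pow_zero, pow_zero, Submonoid.coe_one, one_mulVec, zero_smul, zero_add, one_smul]⟩
    | succ n ih =>
      obtain ⟨r, hr⟩ := ih
      refine ⟨r + d ^ n * s, ?_⟩
      rw [pow_succ', Submonoid.coe_mul, ← mulVec_mulVec, hr, mulVec_add, mulVec_smul, mulVec_smul,
        hc, hd, smul_add, smul_smul, smul_smul, pow_succ, add_smul, add_assoc]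
  have hd1 : d = 1 := by
    obtain ⟨r, hr⟩ := hpow' (p ^ k)
    rw [hk] at hr
    have := congrFun hr (.inl 1)
    exact eq_one_of_pow_char_pow_eq_one (by simpa using this.symm)
  exact ⟨hc, s, by rw [hd, hd1, one_smul]⟩

/-- A `p`-group properly containing the unipotent radical would contain a larger subgroup
normalizing it. -/
theorem exists_sylow_eq_unipotentRadical {p : ℕ} [Fact p.Prime] [CharP F p] [Finite F]
    (hU : IsPGroup p (unipotentRadical F)) :
    ∃ P : Sylow p (symplecticGroup (Fin 2) F), (P : Subgroup _) = unipotentRadical F := by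
  refine ⟨⟨unipotentRadical F, hU, fun {Q} hQ hle => ?_⟩, rfl⟩
  by_contra hne
  have : Group.IsNilpotent Q := hQ.isNilpotent
  have hlt : (unipotentRadical F).subgroupOf Q < ⊤ := by
    rw [lt_top_iff_ne_top, Ne, Subgroup.subgroupOf_eq_top]
    exact fun h => hne (le_antisymm h hle)
  obtain ⟨x, hx, hxU⟩ := SetLike.exists_of_lt (Group.normalizerCondition_of_isNilpotent _ hlt)
  refine hxU (Subgroup.mem_subgroupOf.2 ?_)
  obtain ⟨k, hk⟩ := hQ x
  refine mem_unipotentRadical_of_normalizes (p := p) (k := k)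
    (by exact_mod_cast congrArg Subtype.val hk) fun u hu => ?_
  have := (Subgroup.mem_normalizer_iff''.1 hx ⟨u, hle hu⟩).1 (Subgroup.mem_subgroupOf.2 hu)
  simpa [Subgroup.mem_subgroupOf] using this

variable (F) in
/-- The two simple root coordinates of an element of the unipotent radical are additive. -/
theorem exists_surjective_hom_unipotentRadical :
    ∃ φ : unipotentRadical F →* Multiplicative (F × F), Function.Surjective φ := by
  refine ⟨MonoidHom.mk' (fun g => .ofAdd (g.1.1 (.inl 0) (.inl 1), g.1.1 (.inl 1) (.inr 1))) ?_,
    fun y => ⟨⟨rootElement .α y.toAdd.1 * rootElement .β (-y.toAdd.2) * rootElement .αβ 0 *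
      rootElement .ααβ 0, mul_mem (mul_mem (mul_mem (rootElement_mem _ _)
        (rootElement_mem _ _)) (rootElement_mem _ _)) (rootElement_mem _ _)⟩, ?_⟩⟩
  · rintro ⟨g, hg⟩ ⟨h, hh⟩
    obtain ⟨s, t, u, w, rfl⟩ := exists_eq_prod_rootElement hg
    obtain ⟨s', t', u', w', rfl⟩ := exists_eq_prod_rootElement hh
    rw [← ofAdd_add]
    simp only [MulMemClass.mk_mul_mk]
    rw [Submonoid.coe_mul, coe_prod_rootElement, coe_prod_rootElement, fromBlocks_multiply]
    simp [add_comm]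
  · simp only [MonoidHom.mk'_apply]
    rw [coe_prod_rootElement]
    simp

end Unipotent

/-! ### Generators of the additive group of the field -/

section Generators

variable {p a : ℕ} [Fact p.Prime] {F : Type*} [Field F] {v : Fin a → F}

theorem exists_sum_intCast_mul_eq (hv : AddSubgroup.closure (Set.range v) = ⊤) (t : F) :
    ∃ n : Fin a → ℤ, ∑ k, (n k : F) * v k = t := by
  have ht : t ∈ Submodule.span ℤ (Set.range v) := by
    rw [← Submodule.mem_toAddSubgroup, Submodule.span_int_eq_addSubgroupClosure, hv]
    trivial
  obtain ⟨n, hn⟩ := (Submodule.mem_span_range_iff_exists_fun ℤ).1 ht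
  exact ⟨n, by simpa only [zsmul_eq_mul] using hn⟩

theorem nonempty_exponents (hv : AddSubgroup.closure (Set.range v) = ⊤) :
    Nonempty (Exponents v) := by
  choose n hn using exists_sum_intCast_mul_eq hv
  exact ⟨{ m := fun j i => n (v i / 2) j
           r := fun k i => n (-(v i) ^ 2) k
           c := fun k k' => n (v k * v k')
           d := fun i j => n (v i * v j)
           f := fun i j => n (v i * v j ^ 2)
           m_spec := fun _ => hn _
           r_spec := fun _ => hn _
           c_spec := fun _ _ => hn _
           d_spec := fun _ _ => hn _
           f_spec := fun _ _ => hn _ }⟩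

theorem finrank_zmod_eq [Algebra (ZMod p) F] [Finite F] (hF : Nat.card F = p ^ a) :
    Module.finrank (ZMod p) F = a := by
  have h := Module.natCard_eq_pow_finrank (K := ZMod p) (V := F)
  rw [hF, Nat.card_zmod] at h
  exact (Nat.pow_right_injective (Fact.out : p.Prime).two_le h).symm

/-- Generators of the additive group of `F`, as many as its dimension over the prime field, are
linearly independent over it. -/
theorem dvd_of_sum_intCast_mul_eq_zero [CharP F p] [Finite F] (hF : Nat.card F = p ^ a)
    (hv : AddSubgroup.closure (Set.range v) = ⊤) {n : Fin a → ℤ}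
    (hn : ∑ k, (n k : F) * v k = 0) (k : Fin a) : (p : ℤ) ∣ n k := by
  let _ : Algebra (ZMod p) F := ZMod.algebra F p
  have hspan : ⊤ ≤ Submodule.span (ZMod p) (Set.range v) := fun t _ => by
    obtain ⟨m, rfl⟩ := exists_sum_intCast_mul_eq hv t
    refine Submodule.sum_mem _ fun j _ => ?_
    rw [← zsmul_eq_mul]
    exact zsmul_mem (Submodule.subset_span (Set.mem_range_self j)) _
  have hli := linearIndependent_of_top_le_span_of_card_eq_finrank hspan
    (by rw [Fintype.card_fin, finrank_zmod_eq hF])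
  have h0 := Fintype.linearIndependent_iff.1 hli (fun k => (n k : ZMod p))
    (by simpa [Algebra.smul_def] using hn) k
  exact (ZMod.intCast_zmod_eq_zero_iff_dvd _ _).1 h0

theorem exists_isNormalizedGenerating [NeZero a] [CharP F p] [Finite F]
    (hF : Nat.card F = p ^ a) : ∃ v : Fin a → F, IsNormalizedGenerating v := by
  let _ : Algebra (ZMod p) F := ZMod.algebra F p
  have hli : LinearIndepOn (ZMod p) id ({1} : Set F) :=
    LinearIndepOn.singleton one_ne_zero
  let b := Module.Basis.extend hli
  let i₀ : hli.extend (Set.subset_univ _) :=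
    ⟨1, hli.subset_extend (Set.subset_univ _) (Set.mem_singleton 1)⟩
  have hcard : Nat.card (hli.extend (Set.subset_univ _)) = a := by
    rw [← Module.finrank_eq_nat_card_basis b, finrank_zmod_eq hF]
  obtain ⟨e⟩ : Nonempty (Fin a ≃ hli.extend (Set.subset_univ _)) :=
    ⟨(Finite.equivFinOfCardEq hcard).symm⟩
  -- The enumeration of the basis is permuted so that `1` comes first.
  let e' := (Equiv.swap 0 (e.symm i₀)).trans e
  refine ⟨fun k => b (e' k), ?_, ?_⟩
  · simp [e', b, i₀, Module.Basis.extend_apply_self]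
  · have hr : Set.range (fun k => b (e' k)) = Set.range b := e'.surjective.range_comp b
    have hspan : Submodule.span (ZMod p) (Set.range b) ≤
        AddSubgroup.toZModSubmodule p (AddSubgroup.closure (Set.range b)) :=
      Submodule.span_le.2 AddSubgroup.subset_closure
    rw [b.span_eq] at hspan
    rw [hr, eq_top_iff]
    exact fun t _ => hspan (Submodule.mem_top (x := t))

end Generators

/-! ### The number of relations -/

section Card

theorem two_mul_card_relIndex (a : ℕ) [NeZero a] :
    2 * Nat.card (RelIndex a) = 7 * a ^ 2 + 13 * a := by
  let T := {x : Fin a × Fin a // x.1 < x.2}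
  let N := {x : Fin a × Fin a // x.2 ≠ 0}
  let e : RelIndex a ≃ (Fin 9 × Fin a) ⊕ (Fin 3 × T) ⊕ N ⊕ (Fin a × Fin a) :=
    { toFun := fun
        | .C1α k => .inl (0, k)
        | .C1β k => .inl (1, k)
        | .C1αβ k => .inl (2, k)
        | .C2 k k' h => .inr (.inl (0, ⟨(k, k'), h⟩))
        | .C3 k k' h => .inr (.inl (1, ⟨(k, k'), h⟩))
        | .C4 k k' h => .inr (.inl (2, ⟨(k, k'), h⟩))
        | .C5α k => .inl (3, k)
        | .C5αβ k => .inl (4, k)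
        | .C6 k k' h => .inr (.inr (.inl ⟨(k, k'), h⟩))
        | .C7 i => .inl (5, i)
        | .C8 i => .inl (6, i)
        | .C9 i => .inl (7, i)
        | .C10 i => .inl (8, i)
        | .C11 i j => .inr (.inr (.inr (i, j)))
      invFun := fun
        | .inl (0, k) => .C1α k
        | .inl (1, k) => .C1β k
        | .inl (2, k) => .C1αβ k
        | .inl (3, k) => .C5α k
        | .inl (4, k) => .C5αβ k
        | .inl (5, k) => .C7 k
        | .inl (6, k) => .C8 k
        | .inl (7, k) => .C9 k
        | .inl (8, k) => .C10 k
        | .inr (.inl (0, x)) => .C2 x.1.1 x.1.2 x.2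
        | .inr (.inl (1, x)) => .C3 x.1.1 x.1.2 x.2
        | .inr (.inl (2, x)) => .C4 x.1.1 x.1.2 x.2
        | .inr (.inr (.inl x)) => .C6 x.1.1 x.1.2 x.2
        | .inr (.inr (.inr x)) => .C11 x.1 x.2
      left_inv := fun ι => by cases ι <;> rfl
      right_inv := by
        rintro (⟨i, k⟩ | ⟨i, x⟩ | x | x)
        · fin_cases i <;> rfl
        · fin_cases i <;> rfl
        · rfl
        · rfl }
  -- Off the diagonal, exactly one of a pair and its transpose is increasing.
  have hT : 2 * Nat.card T + a = a ^ 2 := by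
    let f : (T ⊕ T) ⊕ Fin a → Fin a × Fin a :=
      Sum.elim (Sum.elim Subtype.val fun x => x.1.swap) fun k => (k, k)
    have hf : Function.Bijective f := by
      constructor
      · rintro ((⟨⟨i, j⟩, h⟩ | ⟨⟨i, j⟩, h⟩) | i) ((⟨⟨k, l⟩, h'⟩ | ⟨⟨k, l⟩, h'⟩) | k) e <;>
          simp only [f, Sum.elim_inl, Sum.elim_inr, Prod.swap_prod_mk, Prod.mk.injEq] at e <;>
          obtain ⟨rfl, e⟩ := e <;>
          cases e <;>
          first
            | rfl
            | exact absurd h (lt_asymm h')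
            | exact absurd h (lt_irrefl _)
            | exact absurd h' (lt_irrefl _)
      · rintro ⟨i, j⟩
        rcases lt_trichotomy i j with h | rfl | h
        · exact ⟨.inl (.inl ⟨(i, j), h⟩), rfl⟩
        · exact ⟨.inr i, rfl⟩
        · exact ⟨.inl (.inr ⟨(j, i), h⟩), rfl⟩
    have := Nat.card_congr (Equiv.ofBijective f hf)
    simp only [Nat.card_sum, Nat.card_prod, Nat.card_fin] at this
    nlinarith
  have hN : Nat.card N + a = a ^ 2 := by
    have h := Nat.card_congr (Equiv.sumCompl fun x : Fin a × Fin a => x.2 = 0)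
    let f : {x : Fin a × Fin a // x.2 = 0} ≃ Fin a :=
      ⟨fun x => x.1.1, fun k => ⟨(k, 0), rfl⟩, fun ⟨⟨i, j⟩, h⟩ => by simpa using h.symm,
        fun _ => rfl⟩
    rw [Nat.card_sum, Nat.card_congr f, Nat.card_prod, Nat.card_fin] at h
    rw [sq, ← h, add_comm]
  rw [Nat.card_congr e]
  simp only [Nat.card_sum, Nat.card_prod, Nat.card_fin]
  nlinarith

end Card

/-! ### The presentation -/

section Presentation

variable {p a : ℕ} [NeZero a] {F : Type*} [Field F] {v : Fin a → F} (K : Exponents v)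

section Map

variable {G H : Type*} [Group G] [Group H] (φ : G →* H) (A B : Fin a → G)

omit [NeZero a] in
theorem map_halfα (i : Fin a) : φ (halfα K A i) = halfα K (fun k => φ (A k)) i :=
  map_prodPow φ _ _

theorem map_wordαβ (i : Fin a) :
    φ (wordαβ K A B i) = wordαβ K (fun k => φ (A k)) (fun k => φ (B k)) i := by
  simp only [wordαβ, map_mul, map_prodPow, map_commutatorElement, map_halfα]

theorem map_wordααβ (i : Fin a) :
    φ (wordααβ K A B i) = wordααβ K (fun k => φ (A k)) (fun k => φ (B k)) i := by
  simp only [wordααβ, map_commutatorElement, map_halfα, map_wordαβ]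

theorem map_relLHS (ι : RelIndex a) :
    φ (relLHS p K A B ι) = relLHS p K (fun k => φ (A k)) (fun k => φ (B k)) ι := by
  cases ι <;> simp only [relLHS, wordααβMulSq, map_pow, map_inv, map_prodPow,
    map_commutatorElement, map_wordαβ, map_wordααβ]

theorem map_relRHS (ι : RelIndex a) :
    φ (relRHS K A B ι) = relRHS K (fun k => φ (A k)) (fun k => φ (B k)) ι := by
  cases ι <;> simp only [relRHS, wordααβMulSq, wordαβMul, map_one, map_mul, map_inv, map_prodPow,
    map_commutatorElement, map_wordαβ, map_wordααβ]

end Map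

theorem map_relator_eq_one_iff {H : Type*} [Group H] (φ : FreeGroup (Fin a ⊕ Fin a) →* H)
    (ι : RelIndex a) :
    φ (relator p K ι) = 1 ↔
      relLHS p K (fun k => φ (.of (.inl k))) (fun k => φ (.of (.inr k))) ι =
        relRHS K (fun k => φ (.of (.inl k))) (fun k => φ (.of (.inr k))) ι := by
  rw [relator, map_mul, map_inv, map_relLHS, map_relRHS, mul_inv_eq_one]

theorem finite_and_card_le_of_relLHS_eq_relRHS [Fact p.Prime] [CharP F p] [Finite F]
    (hF : Nat.card F = p ^ a) (hv : IsNormalizedGenerating v)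
    {G : Type*} [Group G] {A B : Fin a → G}
    (hgen : Subgroup.closure (Set.range A ∪ Set.range B) = ⊤)
    (hrel : ∀ ι, relLHS p K A B ι = relRHS K A B ι) :
    Finite G ∧ Nat.card G ≤ p ^ (4 * a) := by
  have hcomm : ∀ {g : Fin a → G}, (∀ k l, k < l → ⁅g k, g l⁆ = 1) → ∀ k l, Commute (g k) (g l) :=
    fun {g} h k l => by
      rcases lt_trichotomy k l with hkl | rfl | hkl
      · exact commutatorElement_eq_one_iff_commute.1 (h k l hkl)
      · exact Commute.refl _
      · exact (commutatorElement_eq_one_iff_commute.1 (h l k hkl)).symm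
  have hAA := hcomm fun k l h => hrel (.C2 k l h)
  have hBB := hcomm fun k l h => hrel (.C3 k l h)
  have hPP := hcomm fun k l h => hrel (.C4 k l h)
  have hPp : ∀ k, wordαβ K A B k ^ p = 1 := fun k => hrel (.C1αβ k)
  have hAZ := fun k => commutatorElement_eq_one_iff_commute.1 (hrel (.C5α k))
  have hPZ := fun k => commutatorElement_eq_one_iff_commute.1 (hrel (.C5αβ k))
  have hAP := fun k l h => hrel (.C6 k l h)
  -- As `v 0 = 1`, the `K.c 0 k` are coefficients of `v k` itself.
  have hc : ∀ k j, (p : ℤ) ∣ K.c 0 k j - Pi.single (M := fun _ => ℤ) k 1 j := fun k j => by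
    refine dvd_of_sum_intCast_mul_eq_zero hF hv.closure_eq_top
      (n := fun j => K.c 0 k j - Pi.single (M := fun _ => ℤ) k 1 j) ?_ j
    simp only [Int.cast_sub, sub_mul, Finset.sum_sub_distrib, K.c_spec, hv.first, one_mul]
    simp [Pi.single_apply]
  set Z := Subgroup.closure (Set.range fun k => ⁅A k, wordαβ K A B 0⁆) with hZ
  -- `x_{2α+β}(v_i)` is a commutator of `P 0` with a word in the `A k`, hence lies in `⟨Z⟩`.
  have hQ : ∀ i, wordααβ K A B i ∈ Z := fun i => by
    have hle : ∀ g ∈ Subgroup.closure (Set.range A), ⁅g, wordαβ K A B 0⁆ ∈ Z := fun g hg => by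
      have hAZ' : ∀ g ∈ Subgroup.closure (Set.range A), ∀ z ∈ Z, Commute g z := fun g hg z hz =>
        commute_of_mem_closure (by
          rintro _ ⟨k, rfl⟩
          refine (commute_of_mem_closure ?_ hg).symm
          rintro _ ⟨l, rfl⟩
          exact (commute_commutator_of_heisenberg_relations
            hPP hAZ hPZ hAP hAA (hPp 0) hc l k).symm) hz
      induction hg using Subgroup.closure_induction with
      | one => simp
      | mem _ h =>
        obtain ⟨k, rfl⟩ := h
        exact Subgroup.subset_closure ⟨k, rfl⟩
      | inv g hg ih =>
        have h1 : ⁅g⁻¹, wordαβ K A B 0⁆ = g⁻¹ * ⁅g, wordαβ K A B 0⁆⁻¹ * g⁻¹⁻¹ := by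
          simp only [commutatorElement_def]; group
        rw [h1, (hAZ' g hg _ (inv_mem ih)).inv_left.mul_inv_cancel]
        exact inv_mem ih
      | mul g h hg hh ihg ihh =>
        have h1 : ⁅g * h, wordαβ K A B 0⁆ =
            g * ⁅h, wordαβ K A B 0⁆ * g⁻¹ * ⁅g, wordαβ K A B 0⁆ := by
          simp only [commutatorElement_def]; group
        rw [h1, (hAZ' g hg _ ihh).mul_inv_cancel]
        exact mul_mem ihh ihg
    exact hle _ (prodPow_mem (fun k => Subgroup.subset_closure (Set.mem_range_self k)) _)
  refine finite_and_card_le_of_relations (Fact.out : p.Prime).ne_zero hgen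
    (fun k => hrel (.C1α k)) (fun k => hrel (.C1β k)) hPp hAA hBB hPP hAZ hPZ hAP hc
    (fun i => commutatorElement_eq_one_iff_commute.1 (hrel (.C7 i)))
    (fun i => commutatorElement_eq_one_iff_commute.1 (hrel (.C8 i)))
    (fun i => ⟨_, prodPow_mem hQ _, hrel (.C10 i)⟩)
    (fun i j => ⟨_, ?_, _, prodPow_mem hQ _, hrel (.C11 i j)⟩)
  exact inv_mem (prodPow_mem (fun k => Subgroup.subset_closure (Set.mem_range_self k)) _)

/-- A group of order `p ^ (4 * a)` generated by elements that satisfy the relations is presented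
by them, because the presented group has at most that order. -/
theorem exists_presentedGroup_mulEquiv [Fact p.Prime] [CharP F p] [Finite F]
    (hF : Nat.card F = p ^ a) (hv : IsNormalizedGenerating v)
    {G : Type*} [Group G] {A B : Fin a → G}
    (hgen : Subgroup.closure (Set.range A ∪ Set.range B) = ⊤)
    (hrel : ∀ ι, relLHS p K A B ι = relRHS K A B ι) (hcard : Nat.card G = p ^ (4 * a)) :
    ∃ e : PresentedGroup (Set.range (relator p K)) ≃* G,
      ∀ k, e (.of (.inl k)) = A k ∧ e (.of (.inr k)) = B k := by
  have hlift : ∀ r ∈ Set.range (relator p K), FreeGroup.lift (Sum.elim A B) r = 1 := by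
    rintro _ ⟨ι, rfl⟩
    rw [map_relator_eq_one_iff]
    simpa using hrel ι
  let φ : PresentedGroup (Set.range (relator p K)) →* G := PresentedGroup.toGroup hlift
  have hφ : ∀ i, φ (.of i) = Sum.elim A B i := fun i => PresentedGroup.toGroup.of hlift
  have hsurj : Function.Surjective φ := by
    rw [← MonoidHom.range_eq_top, eq_top_iff, ← hgen, Subgroup.closure_le]
    rintro _ (⟨k, rfl⟩ | ⟨k, rfl⟩)
    exacts [⟨_, hφ (.inl k)⟩, ⟨_, hφ (.inr k)⟩]
  obtain ⟨hfin, hle⟩ := finite_and_card_le_of_relLHS_eq_relRHS K hF hv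
    (A := fun k => (.of (.inl k) : PresentedGroup (Set.range (relator p K))))
    (B := fun k => .of (.inr k))
    (by
      rw [← PresentedGroup.closure_range_of, ← Set.Sum.elim_range]
      congr 2
      funext i
      cases i <;> rfl)
    (fun ι => (map_relator_eq_one_iff K (PresentedGroup.mk _) ι).1
      (PresentedGroup.one_of_mem ⟨ι, rfl⟩))
  exact ⟨MulEquiv.ofBijective φ (hsurj.bijective_of_nat_card_le (hcard ▸ hle)),
    fun k => ⟨hφ (.inl k), hφ (.inr k)⟩⟩

end Presentation

/-! ### Generation by the simple root elements -/

section Generation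

variable {a : ℕ} [NeZero a] {F : Type*} [Field F] {v : Fin a → F} {G : Type*} [Group G]

theorem IsRootFamily.map {x : PosRoot → F → G} (hx : IsRootFamily x) {H : Type*} [Group H]
    (φ : G →* H) : IsRootFamily fun γ t => φ (x γ t) where
  add γ s t := by rw [hx.add, map_mul]
  commutator_β_α t s := by rw [← map_commutatorElement, hx.commutator_β_α, map_mul]
  commutator_α_αβ s t := by rw [← map_commutatorElement, hx.commutator_α_αβ]
  commute_β_αβ s t := (hx.commute_β_αβ s t).map φ
  commute_ααβ γ s t := (hx.commute_ααβ γ s t).map φ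

theorem IsRootFamily.mem_closure {x : PosRoot → F → G} (hx : IsRootFamily x) (h2 : (2 : F) ≠ 0)
    (hv : IsNormalizedGenerating v) (γ : PosRoot) (t : F) :
    x γ t ∈ Subgroup.closure
      (Set.range (fun k => x .α (v k)) ∪ Set.range (fun k => x .β (v k))) := by
  set N := Subgroup.closure
    (Set.range (fun k => x .α (v k)) ∪ Set.range (fun k => x .β (v k))) with hN
  have hspan : ∀ {γ}, (∀ k, x γ (v k) ∈ N) → ∀ t, x γ t ∈ N := fun {γ} h t => by
    obtain ⟨n, rfl⟩ := exists_sum_intCast_mul_eq hv.closure_eq_top t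
    rw [← hx.prodPow_eq]
    exact prodPow_mem h n
  have hα := hspan (γ := .α) fun k => Subgroup.subset_closure (.inl ⟨k, rfl⟩)
  have hβ := hspan (γ := .β) fun k => Subgroup.subset_closure (.inr ⟨k, rfl⟩)
  have hcomm : ∀ {g h : G}, g ∈ N → h ∈ N → ⁅g, h⁆ ∈ N := fun hg hh =>
    mul_mem (mul_mem (mul_mem hg hh) (inv_mem hg)) (inv_mem hh)
  have hβα : ∀ t s, x .αβ (t * s) * x .ααβ (t * s ^ 2) ∈ N := fun t s => by
    rw [← hx.commutator_β_α]
    exact hcomm (hβ t) (hα s)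
  -- The central factor of `⁅x_β(1), x_α(1)⁆` is invisible in a commutator with `x_α`.
  have hααβ : ∀ t, x .ααβ t ∈ N := fun t => by
    have := hcomm (hα (t / 2)) (hβα 1 1)
    rwa [hx.commutator_α_mul, mul_div_cancel₀ _ h2, mul_one, mul_one] at this
  have hαβ : ∀ t, x .αβ t ∈ N := fun t => by
    have := hβα t 1
    rw [mul_one] at this
    exact (mul_mem_cancel_right (hααβ _)).1 this
  cases γ
  exacts [hα t, hβ t, hαβ t, hααβ t]

end Generation

end Sp4Sylow

open Sp4Sylow

theorem mainTheorem12 (p a : ℕ) [Fact p.Prime] (hp : Odd p) [NeZero a]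
    (F : Type*) [Field F] [Finite F] (hF : Nat.card F = p ^ a)
    (S : Sylow p (Matrix.symplecticGroup (Fin 2) F)) :
    Nat.card S = Nat.card F ^ 4 ∧ Nat.card S = p ^ (4 * a) ∧
    Group.rank S = 2 * a ∧
    2 * Nat.card (Sp4Sylow.RelIndex a) = 7 * a ^ 2 + 13 * a ∧
    (∃ v : Fin a → F, Sp4Sylow.IsNormalizedGenerating v) ∧
    ∃ (g : Matrix.symplecticGroup (Fin 2) F) (x : Sp4Sylow.PosRoot → F → S),
      (∀ γ t, (x γ t : Matrix.symplecticGroup (Fin 2) F) =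
        g * Sp4Sylow.rootElement γ t * g⁻¹) ∧
      ∀ v : Fin a → F, Sp4Sylow.IsNormalizedGenerating v →
        Nonempty (Sp4Sylow.Exponents v) ∧
        Subgroup.closure (Set.range (fun k => x .α (v k)) ∪ Set.range (fun k => x .β (v k))) = ⊤ ∧
        ∀ K : Sp4Sylow.Exponents v,
          (∀ i, Sp4Sylow.halfα K (fun k => x .α (v k)) i = x .α (v i / 2)) ∧
          (∀ i, Sp4Sylow.wordαβ K (fun k => x .α (v k)) (fun k => x .β (v k)) i =
            x .αβ (v i)) ∧
          (∀ i, Sp4Sylow.wordααβ K (fun k => x .α (v k)) (fun k => x .β (v k)) i =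
            x .ααβ (v i)) ∧
          ∃ e : PresentedGroup (Set.range (Sp4Sylow.relator p K)) ≃* S,
            ∀ k, e (PresentedGroup.of (Sum.inl k)) = x .α (v k) ∧
              e (PresentedGroup.of (Sum.inr k)) = x .β (v k) := by
  let _ : Fintype F := Fintype.ofFinite F
  have : CharP F p := charP_of_card_eq_prime_pow (by rw [← Nat.card_eq_fintype_card, hF])
  have h2 : (2 : F) ≠ 0 := by
    have := (CharP.cast_eq_zero_iff F p 2).not.2 fun h => by
      have := (Nat.prime_dvd_prime_iff_eq Fact.out Nat.prime_two).1 h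
      subst this
      exact absurd hp (by decide)
    exact_mod_cast this
  have hcardU : Nat.card (unipotentRadical F) = p ^ (4 * a) := by
    rw [card_unipotentRadical, hF, ← pow_mul, mul_comm]
  obtain ⟨P, hP⟩ := exists_sylow_eq_unipotentRadical (F := F) (IsPGroup.of_card hcardU)
  obtain ⟨g, hg⟩ := MulAction.exists_smul_eq (Matrix.symplecticGroup (Fin 2) F) P S
  have hS : (S : Subgroup (Matrix.symplecticGroup (Fin 2) F)) =
      (unipotentRadical F).map (MulAut.conj g).toMonoidHom := by
    rw [← hg, ← hP]; rfl
  let c : unipotentRadical F →* (S : Subgroup (Matrix.symplecticGroup (Fin 2) F)) :=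
    ((MulAut.conj g).toMonoidHom.comp (unipotentRadical F).subtype).codRestrict S fun u =>
      hS.ge (Subgroup.mem_map_of_mem _ u.2)
  have hc : Function.Bijective c := by
    constructor
    · intro u w h
      exact Subtype.ext ((MulAut.conj g).injective (congrArg Subtype.val h))
    · rintro ⟨y, hy⟩
      obtain ⟨u, hu, rfl⟩ := hS ▸ hy
      exact ⟨⟨u, hu⟩, rfl⟩
  let e := MulEquiv.ofBijective c hc
  let x : PosRoot → F → (S : Subgroup (Matrix.symplecticGroup (Fin 2) F)) := fun γ t =>
    c ⟨rootElement γ t, rootElement_mem γ t⟩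
  have hx : IsRootFamily x := (isRootFamily_unipotentRadical F).map c
  have hcard : Nat.card (S : Subgroup (Matrix.symplecticGroup (Fin 2) F)) = p ^ (4 * a) := by
    rw [← Nat.card_congr e.toEquiv, hcardU]
  have hgen : ∀ v : Fin a → F, IsNormalizedGenerating v → Subgroup.closure
      (Set.range (fun k => x .α (v k)) ∪ Set.range (fun k => x .β (v k))) = ⊤ := fun v hv => by
    rw [eq_top_iff]
    intro y _
    obtain ⟨⟨u, hu⟩, rfl⟩ := hc.2 y
    obtain ⟨s, t, w, z, rfl⟩ := exists_eq_prod_rootElement hu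
    have := mul_mem (mul_mem (mul_mem (hx.mem_closure h2 hv .α s) (hx.mem_closure h2 hv .β t))
      (hx.mem_closure h2 hv .αβ w)) (hx.mem_closure h2 hv .ααβ z)
    simp only [x, ← map_mul] at this
    exact this
  refine ⟨by rw [hcard, hF, ← pow_mul, mul_comm], hcard, ?_, two_mul_card_relIndex a,
    exists_isNormalizedGenerating hF, g, x, fun _ _ => rfl, fun v hv =>
      ⟨nonempty_exponents hv.closure_eq_top, hgen v hv, fun K =>
        ⟨hx.halfα_eq K, hx.wordαβ_eq K h2 hv.first, hx.wordααβ_eq K h2 hv.first, ?_⟩⟩⟩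
  · refine le_antisymm ?_ ?_
    · obtain ⟨v, hv⟩ := exists_isNormalizedGenerating hF
      classical
      refine (Group.rank_le (S := Finset.univ.image (fun k => x .α (v k)) ∪
        Finset.univ.image (fun k => x .β (v k))) (by simpa using hgen v hv)).trans ?_
      refine (Finset.card_union_le _ _).trans ?_
      rw [two_mul]
      exact add_le_add (Finset.card_image_le.trans_eq (Finset.card_fin a))
        (Finset.card_image_le.trans_eq (Finset.card_fin a))
    -- `S` maps onto `F × F`, which has exponent `p` and order `p ^ (2 * a)`.
    · obtain ⟨φ, hφ⟩ := exists_surjective_hom_unipotentRadical F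
      have hrank := Group.rank_le_of_surjective (φ.comp e.symm.toMonoidHom)
        (hφ.comp e.symm.surjective)
      have hdvd := card_dvd_exponent_pow_rank' (Multiplicative (F × F)) (n := p) fun y => by
        rw [← ofAdd_toAdd y, ← ofAdd_nsmul,
          show p • y.toAdd = 0 from Prod.ext (by simp) (by simp), ofAdd_zero]
      rw [show Nat.card (Multiplicative (F × F)) = p ^ (2 * a) by
        rw [Nat.card_congr Multiplicative.toAdd, Nat.card_prod, hF]; ring] at hdvd
      exact ((Nat.pow_dvd_pow_iff_le_right (Fact.out : p.Prime).one_lt).1 hdvd).trans hrank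
  · exact exists_presentedGroup_mulEquiv K hF hv (hgen v hv)
      (hx.relLHS_eq_relRHS K h2 hv.first) hcard
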